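/- Let $n\ge 1$ be an integer and let $\beta$ be a real number with $\beta\ge (n+1)/2$ and $\beta>1$. Let $\nu_\beta$ be the generalized Cauchy distribution on $\mathbb{R}^n$, that is, the probability measure with density $\frac1Z(1+|x|^2)^{-\beta}$ with respect to Lebesgue measure, where $|\cdot|$ is the Euclidean norm and $Z=\int_{\mathbb{R}^n}(1+|x|^2)^{-\beta}\,dx$. For a bounded measurable function $g:\mathbb{R}^n\to\mathbb{R}$ put $$\mathrm{Ent}_{\nu_\beta}(g^2)=\int g^2\log g^2\,d\nu_\beta-\int g^2\,d\nu_\beta\,\log\int g^2\,d\nu_\beta ,\qquad 0\log 0=0 .$$ Then for every bounded smooth function $g:\mathbb{R}^n\to\mathbb{R}$, $$\mathrm{Ent}_{\nu_\beta}(g^2)\le\frac1{\beta-1}\int_{\mathbb{R}^n}|\nabla g(x)|^2\,(1+|x|^2)^2\,d\nu_\beta(x),$$ where the right-hand side may be $+\infty$. -/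

import Mathlib

open MeasureTheory
open scoped ENNReal ContDiff

/-- The unnormalized density `(1 + |x|²)^(-β)` on `ℝⁿ` with its Euclidean norm. -/
noncomputable def cauchyDensity (n : ℕ) (β : ℝ) (x : EuclideanSpace ℝ (Fin n)) : ℝ :=
  (1 + ‖x‖ ^ 2) ^ (-β)

/-- The normalizing constant `Z = ∫ (1 + |x|²)^(-β) dx`, finite for `β > n / 2`. -/
noncomputable def cauchyZ (n : ℕ) (β : ℝ) : ℝ :=
  ∫ x, cauchyDensity n β x

/-- The generalized Cauchy distribution on `ℝⁿ`: the measure with density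
`Z⁻¹ (1 + |x|²)^(-β)` with respect to Lebesgue measure. -/
noncomputable def cauchyMeasure (n : ℕ) (β : ℝ) : Measure (EuclideanSpace ℝ (Fin n)) :=
  volume.withDensity fun x => ENNReal.ofReal ((cauchyZ n β)⁻¹ * cauchyDensity n β x)

/-- The entropy `∫ f log f dμ - (∫ f dμ) log (∫ f dμ)` of a nonnegative function,
with `0 log 0 = 0`. -/
noncomputable def entropy {Ω : Type*} [MeasurableSpace Ω] (μ : Measure Ω) (f : Ω → ℝ) : ℝ :=
  (∫ x, f x * Real.log (f x) ∂μ) - (∫ x, f x ∂μ) * Real.log (∫ x, f x ∂μ)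

theorem cauchyDensity_pos (n : ℕ) (β : ℝ) (x : EuclideanSpace ℝ (Fin n)) :
    0 < cauchyDensity n β x := by
  unfold cauchyDensity; positivity

theorem integrable_cauchyDensity {n : ℕ} {β : ℝ} (h : (n : ℝ) / 2 < β) :
    Integrable (cauchyDensity n β) := by
  have := integrable_rpow_neg_one_add_norm_sq (E := EuclideanSpace ℝ (Fin n)) (μ := volume)
    (r := 2 * β) (by rw [finrank_euclideanSpace_fin]; linarith)
  refine this.congr (Filter.Eventually.of_forall fun x => ?_)
  simp only [cauchyDensity]
  congr 1
  ring

theorem cauchyZ_pos {n : ℕ} {β : ℝ} (h : (n : ℝ) / 2 < β) : 0 < cauchyZ n β := by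
  unfold cauchyZ
  rw [integral_pos_iff_support_of_nonneg (fun x => (cauchyDensity_pos n β x).le)
    (integrable_cauchyDensity h)]
  have : Function.support (cauchyDensity n β) = Set.univ := by
    ext x; simp [(cauchyDensity_pos n β x).ne']
  rw [this]
  exact Measure.measure_univ_pos.2 (NeZero.ne _)

/-- For `β > n / 2` the generalized Cauchy distribution is a probability measure. -/
theorem isProbabilityMeasure_cauchyMeasure {n : ℕ} {β : ℝ} (h : (n : ℝ) / 2 < β) :
    IsProbabilityMeasure (cauchyMeasure n β) := by
  constructor
  rw [cauchyMeasure, withDensity_apply _ MeasurableSet.univ, Measure.restrict_univ,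
    ← ofReal_integral_eq_lintegral_ofReal ((integrable_cauchyDensity h).const_mul _)
      (Filter.Eventually.of_forall fun x =>
        mul_nonneg (inv_nonneg.2 (cauchyZ_pos h).le) (cauchyDensity_pos n β x).le),
    integral_const_mul]
  change ENNReal.ofReal ((cauchyZ n β)⁻¹ * cauchyZ n β) = 1
  rw [inv_mul_cancel₀ (cauchyZ_pos h).ne', ENNReal.ofReal_one]

/-!
The generalized Cauchy distribution `ν_β` is the law of `X = Y / R`, where `Y` is a standard Gaussian
vector of `ℝⁿ` and `R` is an independent positive variable with density proportional to
`r ^ (2 β - n - 1) * exp (-r² / 2)`, the chi distribution with `2 β - n` degrees of freedom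
(`map_chiMeasure_prod_gaussian`). The hypothesis `(n + 1) / 2 ≤ β` says that the exponent of `r` is
nonnegative. Then `-log` of the density of `R` has second derivative at least `1`, so `R`, like each
coordinate of `Y`, satisfies the logarithmic Sobolev inequality `Ent (h²) ≤ 2 ∫ |h'|²`, and by
tensorization so does the pair `(R, Y)`.

This inequality is applied to `h (r, y) = g (y / r)`, whose squared gradient is
`(|∇g X|² + ⟨∇g X, X⟩²) / R² ≤ |∇g X|² (1 + |X|²) / R²`
(`entropy_chiMeasure_prod_gaussian_le`). Given `X`, the expectation of `R⁻²` is
`(1 + |X|²) / (2 (β - 1))` (`lintegral_rpow_neg_two_mul`), and this produces both the weight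
`(1 + |x|²)²` and the constant `1 / (β - 1)`.

In one dimension the logarithmic Sobolev inequality is proved by monotone transport
(`integral_mul_log_le_of_transport`). It is done on compact intervals, where the boundary terms of the
integration by parts vanish, and passes to the limit in `entropy_le_lintegral_of_aecover`.
Tensorization rests on the subadditivity of entropy (`entropy_prod_le`). All inequalities are stated
for densities `f = g²` bounded away from `0`, in the form `Ent f ≤ ∫ |∇f|² / (2 f)`; the general case
is recovered by replacing `g²` with `g² + ε`.
-/

open Set Filter Topology

/-! ### Logarithmic Sobolev inequality on an interval -/

/-- The increasing rearrangement of the density `p` onto the density `q` of the same mass, both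
positive and continuous on `[a, b]`. Restricting to a compact interval makes it fix the endpoints. -/
theorem exists_monotone_transport {a b : ℝ} (hab : a < b) {p q : ℝ → ℝ}
    (hp : ContinuousOn p (Icc a b)) (hq : ContinuousOn q (Icc a b))
    (hp0 : ∀ x ∈ Icc a b, 0 < p x) (hq0 : ∀ x ∈ Icc a b, 0 < q x)
    (hpq : ∫ x in a..b, p x = ∫ x in a..b, q x) :
    ∃ T : ℝ → ℝ, T a = a ∧ T b = b ∧ (∀ x ∈ Icc a b, T x ∈ Icc a b) ∧
      ∀ x ∈ Icc a b, HasDerivAt T (p x / q (T x)) x := by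
  -- Extending the densities by constants makes both distribution functions globally `C¹`.
  set p' : ℝ → ℝ := IccExtend hab.le ((Icc a b).domRestrict p) with hp'
  set q' : ℝ → ℝ := IccExtend hab.le ((Icc a b).domRestrict q) with hq'
  have hpc : Continuous p' := (continuousOn_iff_continuous_domRestrict.1 hp).Icc_extend'
  have hqc : Continuous q' := (continuousOn_iff_continuous_domRestrict.1 hq).Icc_extend'
  have hpe : ∀ x ∈ Icc a b, p' x = p x := fun x hx => IccExtend_of_mem _ _ hx
  have hqe : ∀ x ∈ Icc a b, q' x = q x := fun x hx => IccExtend_of_mem _ _ hx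
  have hp'0 : ∀ x, 0 < p' x := fun x => hp0 _ (projIcc a b hab.le x).2
  set P : ℝ → ℝ := fun x => ∫ t in a..x, p' t with hP
  set Q : ℝ → ℝ := fun x => ∫ t in a..x, q' t with hQ
  have hPd : ∀ x, HasDerivAt P (p' x) x := fun x => hpc.integral_hasStrictDerivAt a x |>.hasDerivAt
  have hQd : ∀ x, HasDerivAt Q (q' x) x := fun x => hqc.integral_hasStrictDerivAt a x |>.hasDerivAt
  obtain ⟨x₀, hx₀, hmin⟩ := isCompact_Icc.exists_isMinOn (nonempty_Icc.2 hab.le) hq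
  set m := q x₀ with hm
  have hm0 : 0 < m := hq0 _ hx₀
  have hmq : ∀ x, m ≤ q' x := fun x => hmin (projIcc a b hab.le x).2
  have hmono : Monotone fun x => Q x - m * x := by
    have hd : ∀ x, HasDerivAt (fun x => Q x - m * x) (q' x - m * 1) x := fun x =>
      (hQd x).sub ((hasDerivAt_id x).const_mul m)
    refine monotone_of_deriv_nonneg (fun x => (hd x).differentiableAt) fun x => ?_
    rw [(hd x).deriv]
    linarith [hmq x]
  have hQmono : StrictMono Q := by
    refine strictMono_of_deriv_pos fun x => ?_
    rw [(hQd x).deriv]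
    linarith [hmq x]
  have hQcont : Continuous Q := continuous_iff_continuousAt.2 fun x => (hQd x).continuousAt
  have hQa : Q a = 0 := by simp [hQ]
  have hQsurj : Function.Surjective Q := by
    refine hQcont.surjective ?_ ?_
    · refine tendsto_atTop_mono' atTop (f₁ := fun x => m * x + (0 - m * a)) ?_
        (tendsto_atTop_add_const_right _ _ (tendsto_id.const_mul_atTop hm0))
      filter_upwards [eventually_ge_atTop a] with x hx
      have := hmono hx
      simp only [hQa] at this
      linarith
    · refine tendsto_atBot_mono' atBot (f₁ := fun x => m * x + (0 - m * a)) ?_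
        (tendsto_atBot_add_const_right _ _ (tendsto_id.const_mul_atBot hm0))
      filter_upwards [eventually_le_atBot a] with x hx
      have := hmono hx
      simp only [hQa] at this
      linarith
  set e := hQmono.orderIsoOfSurjective Q hQsurj with he
  have hQe : ∀ y, Q (e.symm y) = y := fun y => e.apply_symm_apply y
  have heq : ∀ x, e.symm (Q x) = x := fun x => e.symm_apply_apply x
  have hT : ∀ x, HasDerivAt (fun x => e.symm (P x)) (p' x / q' (e.symm (P x))) x := by
    intro x
    have h1 : HasDerivAt e.symm (q' (e.symm (P x)))⁻¹ (P x) :=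
      HasDerivAt.of_local_left_inverse e.symm.continuous.continuousAt (hQd _)
        (by linarith [hmq (e.symm (P x))] : 0 < q' (e.symm (P x))).ne'
        (Eventually.of_forall hQe)
    have := h1.comp x (hPd x)
    rw [div_eq_inv_mul]
    exact this
  have hTa : e.symm (P a) = a := by
    have : P a = Q a := by simp [hP, hQ]
    rw [this, heq]
  have hTb : e.symm (P b) = b := by
    have : P b = Q b := by
      simp only [hP, hQ]
      rw [intervalIntegral.integral_congr (g := p), hpq, intervalIntegral.integral_congr (g := q')]
      · intro x hx; rw [uIcc_of_le hab.le] at hx; exact (hqe x hx).symm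
      · intro x hx; rw [uIcc_of_le hab.le] at hx; exact hpe x hx
    rw [this, heq]
  have hPmono : StrictMono P := by
    refine strictMono_of_deriv_pos fun x => ?_
    rw [(hPd x).deriv]
    exact hp'0 x
  have hTmem : ∀ x ∈ Icc a b, e.symm (P x) ∈ Icc a b := by
    intro x hx
    constructor
    · rw [← hTa]; exact e.symm.monotone (hPmono.monotone hx.1)
    · rw [← hTb]; exact e.symm.monotone (hPmono.monotone hx.2)
  refine ⟨fun x => e.symm (P x), hTa, hTb, hTmem, fun x hx => ?_⟩
  have := hT x
  rw [hpe x hx, hqe _ (hTmem x hx)] at this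
  exact this

/-- The logarithmic Sobolev inequality on a compact interval, for a weight `w = exp (-V)` with
`V'' ≥ 1` in the weak form `hconv` (where `l = -V'`) and a density `f` normalized by `hfw`.
With `T` the transport of `f w` onto `w`, taking logarithms in `f w = (w ∘ T) T'` bounds
`f log f w` pointwise by the derivative of `(T - x) f w` plus `f'² / (2 f) w`, and the first term
integrates to zero because `T` fixes the endpoints. -/
theorem integral_mul_log_le_of_transport {a b : ℝ} (hab : a < b) {w l f f' : ℝ → ℝ}
    (hw : ∀ x ∈ Icc a b, HasDerivAt w (l x * w x) x) (hw0 : ∀ x ∈ Icc a b, 0 < w x)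
    (hl : ContinuousOn l (Icc a b))
    (hconv : ∀ x ∈ Icc a b, ∀ t ∈ Icc a b,
      Real.log (w t) - Real.log (w x) ≤ l x * (t - x) - (t - x) ^ 2 / 2)
    (hf : ∀ x ∈ Icc a b, HasDerivAt f (f' x) x) (hf' : ContinuousOn f' (Icc a b))
    (hf0 : ∀ x ∈ Icc a b, 0 < f x)
    (hfw : ∫ x in a..b, f x * w x = ∫ x in a..b, w x) :
    ∫ x in a..b, f x * Real.log (f x) * w x ≤ ∫ x in a..b, f' x ^ 2 / (2 * f x) * w x := by
  have hwc : ContinuousOn w (Icc a b) := fun x hx => (hw x hx).continuousAt.continuousWithinAt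
  have hfc : ContinuousOn f (Icc a b) := fun x hx => (hf x hx).continuousAt.continuousWithinAt
  obtain ⟨T, hTa, hTb, hTm, hTd⟩ := exists_monotone_transport hab (hfc.mul hwc) hwc
    (fun x hx => mul_pos (hf0 x hx) (hw0 x hx)) hw0 hfw
  have hTc : ContinuousOn T (Icc a b) := fun x hx => (hTd x hx).continuousAt.continuousWithinAt
  set T' : ℝ → ℝ := fun x => f x * w x / w (T x) with hT'
  have hwT : ContinuousOn (fun x => w (T x)) (Icc a b) := hwc.comp hTc hTm
  have hT'c : ContinuousOn T' (Icc a b) :=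
    (hfc.mul hwc).div hwT fun x hx => (hw0 _ (hTm x hx)).ne'
  have hlog : ContinuousOn (fun x => Real.log (f x)) (Icc a b) :=
    hfc.log fun x hx => (hf0 x hx).ne'
  set D : ℝ → ℝ := fun x =>
    (T' x - 1) * (f x * w x) + (T x - x) * (f' x * w x + f x * (l x * w x)) with hD
  have hDc : ContinuousOn D (Icc a b) := by fun_prop
  have hFTC : ∫ x in a..b, D x = 0 := by
    have hd : ∀ x ∈ uIcc a b, HasDerivAt (fun x => (T x - x) * (f x * w x)) (D x) x := by
      intro x hx
      rw [uIcc_of_le hab.le] at hx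
      exact ((hTd x hx).sub (hasDerivAt_id x)).mul ((hf x hx).mul (hw x hx))
    rw [intervalIntegral.integral_eq_sub_of_hasDerivAt hd
      (hDc.intervalIntegrable_of_Icc hab.le), hTa, hTb]
    ring
  have hEc : ContinuousOn (fun x => f' x ^ 2 / (2 * f x) * w x) (Icc a b) :=
    ((hf'.pow 2).div (hfc.const_mul 2) fun x hx => by
      have := hf0 x hx; positivity).mul hwc
  have hLc : ContinuousOn (fun x => f x * Real.log (f x) * w x) (Icc a b) := by fun_prop
  calc ∫ x in a..b, f x * Real.log (f x) * w x
      ≤ ∫ x in a..b, (D x + f' x ^ 2 / (2 * f x) * w x) := by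
        refine intervalIntegral.integral_mono_on hab.le (hLc.intervalIntegrable_of_Icc hab.le)
          ((hDc.add hEc).intervalIntegrable_of_Icc hab.le) fun x hx => ?_
        have hfx := hf0 x hx
        have hwx := hw0 x hx
        have hwTx := hw0 _ (hTm x hx)
        have hT'0 : 0 < T' x := by simp only [hT']; positivity
        have h1 : Real.log (f x) = Real.log (T' x) + (Real.log (w (T x)) - Real.log (w x)) := by
          simp only [hT']
          rw [Real.log_div (by positivity) hwTx.ne', Real.log_mul hfx.ne' hwx.ne']
          ring
        have h2 : Real.log (f x) ≤
            T' x - 1 + (l x * (T x - x) - (T x - x) ^ 2 / 2) := by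
          rw [h1]
          exact add_le_add (Real.log_le_sub_one_of_pos hT'0) (hconv x hx _ (hTm x hx))
        have h3 : f x * Real.log (f x) * w x ≤
            f x * (T' x - 1 + (l x * (T x - x) - (T x - x) ^ 2 / 2)) * w x := by gcongr
        -- Young's inequality absorbs the term `(T - x) f'` left by the integration by parts.
        have h4 : 0 ≤ w x * (f' x + (T x - x) * f x) ^ 2 / (2 * f x) := by positivity
        have h5 : w x * (f' x + (T x - x) * f x) ^ 2 / (2 * f x) =
            f' x ^ 2 / (2 * f x) * w x + (T x - x) * (f' x * w x) +
              f x * w x * (T x - x) ^ 2 / 2 := by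
          field_simp
          ring
        simp only [hD]
        nlinarith [h3, h4, h5]
    _ = ∫ x in a..b, f' x ^ 2 / (2 * f x) * w x := by
        rw [intervalIntegral.integral_add (hDc.intervalIntegrable_of_Icc hab.le)
          (hEc.intervalIntegrable_of_Icc hab.le), hFTC, zero_add]

theorem abs_log_le_of_mem_Icc {c C t : ℝ} (hc : 0 < c) (h1 : c ≤ t) (h2 : t ≤ C) :
    |Real.log t| ≤ |Real.log c| + |Real.log C| := by
  have h3 : Real.log c ≤ Real.log t := Real.log_le_log hc h1
  have h4 : Real.log t ≤ Real.log C := Real.log_le_log (hc.trans_le h1) h2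
  rw [abs_le]
  constructor
  · linarith [neg_abs_le (Real.log c), abs_nonneg (Real.log C)]
  · linarith [le_abs_self (Real.log C), abs_nonneg (Real.log c)]

theorem abs_mul_log_le_of_mem_Icc {c C t : ℝ} (hc : 0 < c) (h1 : c ≤ t) (h2 : t ≤ C) :
    |t * Real.log t| ≤ C * (|Real.log c| + |Real.log C|) := by
  rw [abs_mul, abs_of_pos (hc.trans_le h1)]
  exact mul_le_mul h2 (abs_log_le_of_mem_Icc hc h1 h2) (abs_nonneg _)
    (hc.le.trans (h1.trans h2))

/-- The homogeneous form of `integral_mul_log_le_of_transport`, without normalization of `f`. -/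
theorem integral_mul_log_sub_le {a b : ℝ} (hab : a < b) {w l f f' : ℝ → ℝ}
    (hw : ∀ x ∈ Icc a b, HasDerivAt w (l x * w x) x) (hw0 : ∀ x ∈ Icc a b, 0 < w x)
    (hl : ContinuousOn l (Icc a b))
    (hconv : ∀ x ∈ Icc a b, ∀ t ∈ Icc a b,
      Real.log (w t) - Real.log (w x) ≤ l x * (t - x) - (t - x) ^ 2 / 2)
    (hf : ∀ x ∈ Icc a b, HasDerivAt f (f' x) x) (hf' : ContinuousOn f' (Icc a b))
    (hf0 : ∀ x ∈ Icc a b, 0 < f x) :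
    (∫ x in a..b, f x * Real.log (f x) * w x) -
        (∫ x in a..b, f x * w x) * Real.log ((∫ x in a..b, f x * w x) / ∫ x in a..b, w x) ≤
      ∫ x in a..b, f' x ^ 2 / (2 * f x) * w x := by
  have hwc : ContinuousOn w (Icc a b) := fun x hx => (hw x hx).continuousAt.continuousWithinAt
  have hfc : ContinuousOn f (Icc a b) := fun x hx => (hf x hx).continuousAt.continuousWithinAt
  have hlog : ContinuousOn (fun x => Real.log (f x)) (Icc a b) :=
    hfc.log fun x hx => (hf0 x hx).ne'
  have hA : 0 < ∫ x in a..b, f x * w x :=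
    intervalIntegral.intervalIntegral_pos_of_pos_on
      ((hfc.mul hwc).intervalIntegrable_of_Icc hab.le)
      (fun x hx => mul_pos (hf0 x (Ioo_subset_Icc_self hx)) (hw0 x (Ioo_subset_Icc_self hx))) hab
  have hB : 0 < ∫ x in a..b, w x :=
    intervalIntegral.intervalIntegral_pos_of_pos_on (hwc.intervalIntegrable_of_Icc hab.le)
      (fun x hx => hw0 x (Ioo_subset_Icc_self hx)) hab
  set A := ∫ x in a..b, f x * w x with hAdef
  set B := ∫ x in a..b, w x with hBdef
  set m := A / B with hm
  have hm0 : 0 < m := div_pos hA hB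
  have key := integral_mul_log_le_of_transport hab (f := fun x => f x / m) (f' := fun x => f' x / m)
    hw hw0 hl hconv (fun x hx => (hf x hx).div_const m) (hf'.div_const m)
    (fun x hx => div_pos (hf0 x hx) hm0) (by
      have : ∀ x, f x / m * w x = m⁻¹ * (f x * w x) := fun x => by ring
      simp only [this, intervalIntegral.integral_const_mul]
      rw [← hAdef, ← hBdef, hm]
      field_simp)
  have e1 : ∫ x in a..b, f x / m * Real.log (f x / m) * w x =
      m⁻¹ * ((∫ x in a..b, f x * Real.log (f x) * w x) - A * Real.log m) := by
    rw [hAdef, ← intervalIntegral.integral_mul_const, ← intervalIntegral.integral_sub,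
      ← intervalIntegral.integral_const_mul]
    · refine intervalIntegral.integral_congr fun x hx => ?_
      rw [uIcc_of_le hab.le] at hx
      rw [Real.log_div (hf0 x hx).ne' hm0.ne']
      ring
    · exact ((hfc.mul hlog).mul hwc).intervalIntegrable_of_Icc hab.le
    · exact ((hfc.mul hwc).mul continuousOn_const).intervalIntegrable_of_Icc hab.le
  have e2 : ∫ x in a..b, (f' x / m) ^ 2 / (2 * (f x / m)) * w x =
      m⁻¹ * ∫ x in a..b, f' x ^ 2 / (2 * f x) * w x := by
    rw [← intervalIntegral.integral_const_mul]
    refine intervalIntegral.integral_congr fun x hx => ?_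
    rw [uIcc_of_le hab.le] at hx
    have := hf0 x hx
    field_simp
  rw [e1, e2] at key
  exact le_of_mul_le_mul_left key (inv_pos.2 hm0)

/-- The one-dimensional Bakry–Émery inequality: a probability measure on `I` whose density is
`exp (-V)` with `V'' ≥ 1` satisfies `Ent f ≤ ∫ f'² / (2 f)`. It
follows from the case of a compact interval by exhausting `I`. -/
theorem entropy_le_lintegral_of_aecover {I : Set ℝ} (hI : MeasurableSet I) {a b : ℕ → ℝ}
    (hab : ∀ k, a k < b k) (hsub : ∀ k, Icc (a k) (b k) ⊆ I)
    (hcov : AECover (volume.restrict I) atTop fun k => Icc (a k) (b k))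
    {w l f f' : ℝ → ℝ}
    (hw : ∀ x ∈ I, HasDerivAt w (l x * w x) x) (hw0 : ∀ x ∈ I, 0 < w x)
    (hl : ContinuousOn l I)
    (hconv : ∀ x ∈ I, ∀ t ∈ I,
      Real.log (w t) - Real.log (w x) ≤ l x * (t - x) - (t - x) ^ 2 / 2)
    (hwi : IntegrableOn w I) (hw1 : ∫ x in I, w x = 1)
    (hf : ∀ x ∈ I, HasDerivAt f (f' x) x) (hf' : ContinuousOn f' I)
    {c C : ℝ} (hc : 0 < c) (hcf : ∀ x ∈ I, c ≤ f x) (hfC : ∀ x ∈ I, f x ≤ C) :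
    ENNReal.ofReal
        (entropy ((volume.restrict I).withDensity fun x => ENNReal.ofReal (w x)) f) ≤
      ∫⁻ x, ENNReal.ofReal (f' x ^ 2 / (2 * f x))
        ∂(volume.restrict I).withDensity fun x => ENNReal.ofReal (w x) := by
  have hwc : ContinuousOn w I := fun x hx => (hw x hx).continuousAt.continuousWithinAt
  have hfc : ContinuousOn f I := fun x hx => (hf x hx).continuousAt.continuousWithinAt
  have hf0 : ∀ x ∈ I, 0 < f x := fun x hx => hc.trans_le (hcf x hx)
  have hlog : ContinuousOn (fun x => Real.log (f x)) I :=
    hfc.log fun x hx => (hf0 x hx).ne'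
  have hwm : AEMeasurable (fun x => ENNReal.ofReal (w x)) (volume.restrict I) :=
    (hwc.aemeasurable hI).ennreal_ofReal
  have hEc : ContinuousOn (fun x => f' x ^ 2 / (2 * f x)) I :=
    (hf'.pow 2).div (hfc.const_mul 2) fun x hx => by
      have := hf0 x hx; positivity
  have hint : ∀ h : ℝ → ℝ,
      ∫ x, h x ∂(volume.restrict I).withDensity (fun x => ENNReal.ofReal (w x)) =
        ∫ x in I, h x * w x := by
    intro h
    rw [integral_withDensity_eq_integral_toReal_smul₀ hwm (by simp)]
    refine setIntegral_congr_fun hI fun x hx => ?_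
    simp only [ENNReal.toReal_ofReal (hw0 x hx).le, smul_eq_mul]
    ring
  rw [lintegral_withDensity_eq_lintegral_mul₀ hwm (hEc.aemeasurable hI).ennreal_ofReal]
  unfold entropy
  rw [hint, hint]
  have hfw : IntegrableOn (fun x => f x * w x) I := by
    refine Integrable.mono' (hwi.const_mul C) ((hfc.mul hwc).aestronglyMeasurable hI) ?_
    refine (ae_restrict_iff' hI).2 (Eventually.of_forall fun x hx => ?_)
    rw [Real.norm_eq_abs, abs_mul, abs_of_pos (hf0 x hx), abs_of_pos (hw0 x hx)]
    exact mul_le_mul_of_nonneg_right (hfC x hx) (hw0 x hx).le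
  have hflw : IntegrableOn (fun x => f x * Real.log (f x) * w x) I := by
    refine Integrable.mono' (hwi.const_mul (C * (|Real.log c| + |Real.log C|)))
      (((hfc.mul hlog).mul hwc).aestronglyMeasurable hI) ?_
    refine (ae_restrict_iff' hI).2 (Eventually.of_forall fun x hx => ?_)
    rw [Real.norm_eq_abs, abs_mul, abs_of_pos (hw0 x hx)]
    exact mul_le_mul_of_nonneg_right (abs_mul_log_le_of_mem_Icc hc (hcf x hx) (hfC x hx))
      (hw0 x hx).le
  have hmean : 0 < ∫ x in I, f x * w x := by
    have : c * ∫ x in I, w x ≤ ∫ x in I, f x * w x := by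
      rw [← integral_const_mul]
      exact setIntegral_mono_on (hwi.const_mul c) hfw hI fun x hx =>
        mul_le_mul_of_nonneg_right (hcf x hx) (hw0 x hx).le
    rw [hw1] at this
    linarith
  have hset : ∀ (h : ℝ → ℝ) (k : ℕ),
      ∫ x in Icc (a k) (b k), h x ∂volume.restrict I = ∫ x in (a k)..(b k), h x := by
    intro h k
    rw [Measure.restrict_restrict measurableSet_Icc, inter_eq_left.2 (hsub k),
      integral_Icc_eq_integral_Ioc, intervalIntegral.integral_of_le (hab k).le]
  have t1 := hcov.integral_tendsto_of_countably_generated hflw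
  have t2 := hcov.integral_tendsto_of_countably_generated hfw
  have t3 := hcov.integral_tendsto_of_countably_generated hwi
  simp only [hset] at t1 t2 t3
  rw [hw1] at t3
  have t4 := t1.sub (t2.mul ((t2.div t3 one_ne_zero).log (by simpa using hmean.ne')))
  rw [div_one] at t4
  refine le_of_tendsto ((ENNReal.continuous_ofReal.tendsto _).comp t4)
    (Eventually.of_forall fun k => ?_)
  have hk := hsub k
  have hEk : ContinuousOn (fun x => f' x ^ 2 / (2 * f x) * w x) (Icc (a k) (b k)) :=
    (hEc.mul hwc).mono hk
  have h1 := integral_mul_log_sub_le (hab k) (fun x hx => hw x (hk hx))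
    (fun x hx => hw0 x (hk hx)) (hl.mono hk) (fun x hx t ht => hconv x (hk hx) t (hk ht))
    (fun x hx => hf x (hk hx)) (hf'.mono hk) (fun x hx => hf0 x (hk hx))
  refine (ENNReal.ofReal_le_ofReal h1).trans ?_
  rw [intervalIntegral.integral_of_le (hab k).le, ← integral_Icc_eq_integral_Ioc,
    ofReal_integral_eq_lintegral_ofReal hEk.integrableOn_Icc
      ((ae_restrict_iff' measurableSet_Icc).2 (Eventually.of_forall fun x hx => by
        have := hf0 x (hk hx); have := hw0 x (hk hx)
        simp only [Pi.zero_apply]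
        positivity))]
  refine (lintegral_mono_set hk).trans (setLIntegral_mono' hI fun x hx => ?_)
  rw [mul_comm, ENNReal.ofReal_mul (hw0 x hx).le]
  rfl

/-! ### Subadditivity of entropy -/

section
variable {α β : Type*} [MeasurableSpace α] [MeasurableSpace β]

theorem integrable_of_abs_le {μ : Measure α} [IsFiniteMeasure μ] {f : α → ℝ} (hf : Measurable f)
    {K : ℝ} (hK : ∀ x, |f x| ≤ K) : Integrable f μ :=
  Integrable.of_bound hf.aestronglyMeasurable K (Eventually.of_forall hK)

theorem integrable_of_mem_Icc {μ : Measure α} [IsFiniteMeasure μ] {f : α → ℝ} (hf : Measurable f)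
    {c C : ℝ} (hc : 0 < c) (hcf : ∀ x, c ≤ f x) (hfC : ∀ x, f x ≤ C) : Integrable f μ :=
  integrable_of_abs_le hf fun x => by rw [abs_of_pos (hc.trans_le (hcf x))]; exact hfC x

theorem integrable_mul_log {μ : Measure α} [IsFiniteMeasure μ] {f : α → ℝ} (hf : Measurable f)
    {c C : ℝ} (hc : 0 < c) (hcf : ∀ x, c ≤ f x) (hfC : ∀ x, f x ≤ C) :
    Integrable (fun x => f x * Real.log (f x)) μ :=
  integrable_of_abs_le (hf.mul hf.log) fun x => abs_mul_log_le_of_mem_Icc hc (hcf x) (hfC x)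

theorem le_integral_of_forall_le {μ : Measure α} [IsProbabilityMeasure μ] {f : α → ℝ}
    (hf : Integrable f μ) {c : ℝ} (h : ∀ x, c ≤ f x) : c ≤ ∫ x, f x ∂μ := by
  simpa using integral_mono (integrable_const c) hf h

theorem integral_le_of_forall_le {μ : Measure α} [IsProbabilityMeasure μ] {f : α → ℝ}
    (hf : Integrable f μ) {c : ℝ} (h : ∀ x, f x ≤ c) : ∫ x, f x ∂μ ≤ c := by
  simpa using integral_mono hf (integrable_const c) h

/-- The Gibbs variational principle. -/
theorem integral_mul_le_entropy {μ : Measure α} [IsProbabilityMeasure μ] {f φ : α → ℝ}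
    (hf : Measurable f) {c C : ℝ} (hc : 0 < c) (hcf : ∀ x, c ≤ f x) (hfC : ∀ x, f x ≤ C)
    (hφ : Measurable φ) {K : ℝ} (hK : ∀ x, |φ x| ≤ K) (hexp : ∫ x, Real.exp (φ x) ∂μ ≤ 1) :
    ∫ x, f x * φ x ∂μ ≤ entropy μ f := by
  have hfi := integrable_of_mem_Icc (μ := μ) hf hc hcf hfC
  have hfl := integrable_mul_log (μ := μ) hf hc hcf hfC
  have hf0 : ∀ x, 0 < f x := fun x => hc.trans_le (hcf x)
  have hM : 0 < ∫ x, f x ∂μ := hc.trans_le (le_integral_of_forall_le hfi hcf)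
  set M := ∫ x, f x ∂μ with hMdef
  have hei : Integrable (fun x => Real.exp (φ x)) μ :=
    integrable_of_abs_le hφ.exp (K := Real.exp K) fun x => by
      rw [Real.abs_exp]
      exact Real.exp_le_exp.2 ((le_abs_self _).trans (hK x))
  have hfφ : Integrable (fun x => f x * φ x) μ :=
    integrable_of_abs_le (hf.mul hφ) (K := C * K) fun x => by
      rw [abs_mul, abs_of_pos (hf0 x)]
      exact mul_le_mul (hfC x) (hK x) (abs_nonneg _) ((hf0 x).le.trans (hfC x))
  have key : ∀ x, f x * φ x ≤
      f x * Real.log (f x) - f x * Real.log M + (M * Real.exp (φ x) - f x) := by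
    intro x
    have h1 := Real.log_le_sub_one_of_pos
      (div_pos (mul_pos hM (Real.exp_pos (φ x))) (hf0 x))
    rw [Real.log_div (by positivity) (hf0 x).ne', Real.log_mul hM.ne' (Real.exp_pos _).ne',
      Real.log_exp] at h1
    have h2 := mul_le_mul_of_nonneg_left h1 (hf0 x).le
    have h3 : f x * (M * Real.exp (φ x) / f x - 1) = M * Real.exp (φ x) - f x := by
      have := (hf0 x).ne'
      field_simp
    rw [h3] at h2
    linarith
  have i1 : Integrable (fun x => f x * Real.log (f x) - f x * Real.log M) μ :=
    hfl.sub (hfi.mul_const _)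
  have i2 : Integrable (fun x => M * Real.exp (φ x) - f x) μ := (hei.const_mul M).sub hfi
  have h := integral_mono hfφ (i1.add i2) key
  have e : ∫ x, (f x * Real.log (f x) - f x * Real.log M + (M * Real.exp (φ x) - f x)) ∂μ =
      entropy μ f + (M * ∫ x, Real.exp (φ x) ∂μ - M) := by
    rw [integral_add i1 i2, integral_sub hfl (hfi.mul_const _), integral_sub (hei.const_mul M) hfi,
      integral_mul_const, integral_const_mul]
    rfl
  have h' := h.trans_eq e
  nlinarith

theorem entropy_nonneg {μ : Measure α} [IsProbabilityMeasure μ] {f : α → ℝ}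
    (hf : Measurable f) {c C : ℝ} (hc : 0 < c) (hcf : ∀ x, c ≤ f x) (hfC : ∀ x, f x ≤ C) :
    0 ≤ entropy μ f := by
  simpa using integral_mul_le_entropy (φ := fun _ => (0 : ℝ)) (K := 0) (μ := μ) hf hc hcf hfC
    measurable_const (by simp) (by simp)

theorem integrable_entropy_prodMk_left {μ : Measure α} {ν : Measure β} [IsProbabilityMeasure μ]
    [IsProbabilityMeasure ν] {f : α × β → ℝ} (hf : Measurable f) {c C : ℝ} (hc : 0 < c)
    (hcf : ∀ z, c ≤ f z) (hfC : ∀ z, f z ≤ C) :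
    Integrable (fun x => entropy ν fun y => f (x, y)) μ := by
  have h1 := (integrable_mul_log (μ := μ.prod ν) hf hc hcf hfC).integral_prod_left
  refine h1.sub ?_
  have hs : ∀ x, Integrable (fun y => f (x, y)) ν := fun x =>
    integrable_of_mem_Icc (hf.comp measurable_prodMk_left) hc (fun y => hcf _) (fun y => hfC _)
  exact integrable_mul_log
    (hf.stronglyMeasurable.integral_prod_right' (ν := ν)).measurable hc
    (fun x => le_integral_of_forall_le (hs x) fun y => hcf _)
    (fun x => integral_le_of_forall_le (hs x) fun y => hfC _)

/-- Subadditivity of entropy on a product of two probability spaces. Writing `u y = ∫ f (x, y) dμ`,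
the chain rule leaves the entropy of `u`; the Gibbs principle for `f (x, ·)` with the test function
`log (u / ∫ u)` bounds it by the average of the entropies of `f (x, ·)`. -/
theorem entropy_prod_le {μ : Measure α} {ν : Measure β} [IsProbabilityMeasure μ]
    [IsProbabilityMeasure ν] {f : α × β → ℝ} (hf : Measurable f) {c C : ℝ} (hc : 0 < c)
    (hcf : ∀ z, c ≤ f z) (hfC : ∀ z, f z ≤ C) :
    entropy (μ.prod ν) f ≤
      (∫ x, entropy ν (fun y => f (x, y)) ∂μ) + ∫ y, entropy μ (fun x => f (x, y)) ∂ν := by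
  have hfi := integrable_of_mem_Icc (μ := μ.prod ν) hf hc hcf hfC
  have hfl := integrable_mul_log (μ := μ.prod ν) hf hc hcf hfC
  have hs : ∀ y, Integrable (fun x => f (x, y)) μ := fun y =>
    integrable_of_mem_Icc (hf.comp measurable_prodMk_right) hc (fun x => hcf _) (fun x => hfC _)
  set u : β → ℝ := fun y => ∫ x, f (x, y) ∂μ with hu
  have hum : Measurable u :=
    (hf.stronglyMeasurable.integral_prod_left' (μ := μ)).measurable
  have hcu : ∀ y, c ≤ u y := fun y => le_integral_of_forall_le (hs y) fun x => hcf _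
  have huC : ∀ y, u y ≤ C := fun y => integral_le_of_forall_le (hs y) fun x => hfC _
  have hui := integrable_of_mem_Icc (μ := ν) hum hc hcu huC
  have hul := integrable_mul_log (μ := ν) hum hc hcu huC
  have hm : ∫ z, f z ∂μ.prod ν = ∫ y, u y ∂ν := integral_prod_symm f hfi
  have hm0 : 0 < ∫ y, u y ∂ν := hc.trans_le (le_integral_of_forall_le hui hcu)
  set m := ∫ y, u y ∂ν with hmdef
  have hmC : m ≤ C := integral_le_of_forall_le hui huC
  have hcm : c ≤ m := le_integral_of_forall_le hui hcu
  set φ : β → ℝ := fun y => Real.log (u y) - Real.log m with hφ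
  have hφm : Measurable φ := hum.log.sub_const _
  set K := |Real.log c| + |Real.log C| with hKdef
  have hφK : ∀ y, |φ y| ≤ K + K := fun y =>
    (abs_sub _ _).trans (add_le_add (abs_log_le_of_mem_Icc hc (hcu y) (huC y))
      (abs_log_le_of_mem_Icc hc hcm hmC))
  have hφexp : ∫ y, Real.exp (φ y) ∂ν ≤ 1 := by
    have : ∀ y, Real.exp (φ y) = u y / m := fun y => by
      simp only [hφ]
      rw [Real.exp_sub, Real.exp_log (hc.trans_le (hcu y)), Real.exp_log hm0]
    simp only [this, integral_div]
    rw [← hmdef, div_self hm0.ne']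
  have hfφ : Integrable (fun z : α × β => f z * φ z.2) (μ.prod ν) :=
    integrable_of_abs_le (hf.mul (hφm.comp measurable_snd)) (K := C * (K + K)) fun z => by
      rw [abs_mul, abs_of_pos (hc.trans_le (hcf z))]
      exact mul_le_mul (hfC z) (hφK _) (abs_nonneg _) (hc.le.trans ((hcf z).trans (hfC z)))
  have e1 : ∫ y, entropy μ (fun x => f (x, y)) ∂ν =
      (∫ z, f z * Real.log (f z) ∂μ.prod ν) - ∫ y, u y * Real.log (u y) ∂ν := by
    rw [integral_prod_symm _ hfl, ← integral_sub hfl.integral_prod_right hul]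
    rfl
  have e2 : ∫ z, f z * φ z.2 ∂μ.prod ν = (∫ y, u y * Real.log (u y) ∂ν) - m * Real.log m := by
    rw [integral_prod_symm _ hfφ]
    have : ∀ y, ∫ x, f (x, y) * φ y ∂μ = u y * Real.log (u y) - u y * Real.log m := fun y => by
      rw [integral_mul_const, ← mul_sub]
    simp only [this]
    rw [integral_sub hul (hui.mul_const _), integral_mul_const]
  have e3 : ∫ z, f z * φ z.2 ∂μ.prod ν ≤ ∫ x, entropy ν (fun y => f (x, y)) ∂μ := by
    rw [integral_prod _ hfφ]
    exact integral_mono hfφ.integral_prod_left (integrable_entropy_prodMk_left hf hc hcf hfC)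
      fun x => integral_mul_le_entropy (hf.comp measurable_prodMk_left) hc (fun y => hcf _)
        (fun y => hfC _) hφm hφK hφexp
  rw [e2] at e3
  rw [e1]
  unfold entropy at e3 ⊢
  rw [hm]
  linarith

theorem ofReal_entropy_prod_le {μ : Measure α} {ν : Measure β} [IsProbabilityMeasure μ]
    [IsProbabilityMeasure ν] {f : α × β → ℝ} (hf : Measurable f) {c C : ℝ} (hc : 0 < c)
    (hcf : ∀ z, c ≤ f z) (hfC : ∀ z, f z ≤ C) :
    ENNReal.ofReal (entropy (μ.prod ν) f) ≤
      (∫⁻ x, ENNReal.ofReal (entropy ν fun y => f (x, y)) ∂μ) +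
        ∫⁻ y, ENNReal.ofReal (entropy μ fun x => f (x, y)) ∂ν := by
  have h1 := integrable_entropy_prodMk_left (μ := μ) (ν := ν) hf hc hcf hfC
  have h2 := integrable_entropy_prodMk_left (μ := ν) (ν := μ) (hf.comp measurable_swap) hc
    (fun z => hcf z.swap) (fun z => hfC z.swap)
  refine (ENNReal.ofReal_le_ofReal (entropy_prod_le hf hc hcf hfC)).trans ?_
  refine ENNReal.ofReal_add_le.trans (add_le_add ?_ ?_)
  · rw [ofReal_integral_eq_lintegral_ofReal h1 (Eventually.of_forall fun x =>
      entropy_nonneg (hf.comp measurable_prodMk_left) hc (fun y => hcf _) (fun y => hfC _))]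
  · exact (ofReal_integral_eq_lintegral_ofReal h2 (Eventually.of_forall fun y =>
      entropy_nonneg (hf.comp measurable_prodMk_right) hc (fun y => hcf _)
        (fun y => hfC _))).le

end

/-! ### Gaussian logarithmic Sobolev inequality -/

open ProbabilityTheory in
theorem entropy_gaussianReal_le {f f' : ℝ → ℝ} (hf : ∀ x, HasDerivAt f (f' x) x)
    (hf' : Continuous f') {c C : ℝ} (hc : 0 < c) (hcf : ∀ x, c ≤ f x) (hfC : ∀ x, f x ≤ C) :
    ENNReal.ofReal (entropy (gaussianReal 0 1) f) ≤
      ∫⁻ x, ENNReal.ofReal (f' x ^ 2 / (2 * f x)) ∂gaussianReal 0 1 := by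
  have hμ : gaussianReal 0 1 =
      (volume.restrict univ).withDensity fun x => ENNReal.ofReal (gaussianPDFReal 0 1 x) := by
    rw [gaussianReal_of_var_ne_zero 0 one_ne_zero, Measure.restrict_univ]
    rfl
  have hw : ∀ x, gaussianPDFReal 0 1 x =
      (Real.sqrt (2 * Real.pi))⁻¹ * Real.exp (-x ^ 2 / 2) := fun x => by
    simp [gaussianPDFReal]
  have hlog : ∀ x, Real.log (gaussianPDFReal 0 1 x) =
      Real.log (Real.sqrt (2 * Real.pi))⁻¹ + -x ^ 2 / 2 := fun x => by
    rw [hw, Real.log_mul (by positivity) (Real.exp_pos _).ne', Real.log_exp]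
  rw [hμ]
  refine entropy_le_lintegral_of_aecover MeasurableSet.univ (a := fun k : ℕ => -((k : ℝ) + 1))
    (b := fun k : ℕ => (k : ℝ) + 1) (l := fun x => -x) (fun k => ?_) (fun k => subset_univ _) ?_
    (fun x _ => ?_) (fun x _ => gaussianPDFReal_pos 0 1 x one_ne_zero)
    continuous_neg.continuousOn (fun x _ t _ => ?_) ?_ ?_ (fun x _ => hf x) hf'.continuousOn hc
    (fun x _ => hcf x) (fun x _ => hfC x)
  · have : (0 : ℝ) ≤ k := k.cast_nonneg
    linarith
  · have h1 : Tendsto (fun k : ℕ => (k : ℝ) + 1) atTop atTop :=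
      tendsto_atTop_add_const_right _ _ tendsto_natCast_atTop_atTop
    exact aecover_Icc (tendsto_neg_atTop_atBot.comp h1) h1
  · have h1 : HasDerivAt (fun x : ℝ => -x ^ 2 / 2) (-x) x :=
      ((hasDerivAt_pow 2 x).neg.div_const 2).congr_deriv (by push_cast; ring)
    have h2 := (h1.exp).const_mul (Real.sqrt (2 * Real.pi))⁻¹
    rw [hw, funext hw]
    exact h2.congr_deriv (by ring)
  · rw [hlog, hlog]
    apply le_of_eq
    ring
  · exact (integrable_gaussianPDFReal 0 1).integrableOn
  · rw [Measure.restrict_univ]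
    exact integral_gaussianPDFReal_eq_one 0 one_ne_zero

theorem entropy_map {α β : Type*} [MeasurableSpace α] [MeasurableSpace β] {μ : Measure α}
    {X : α → β} (hX : Measurable X) {f : β → ℝ} (hf : Measurable f) :
    entropy (μ.map X) f = entropy μ fun x => f (X x) := by
  have hfl : Measurable fun y => f y * Real.log (f y) := hf.mul hf.log
  unfold entropy
  rw [integral_map hX.aemeasurable hfl.aestronglyMeasurable,
    integral_map hX.aemeasurable hf.aestronglyMeasurable]

theorem Fin.cons_add_smul_single_zero {n : ℕ} (t s : ℝ) (y : Fin n → ℝ) :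
    (Fin.cons t y : Fin (n + 1) → ℝ) + s • Pi.single 0 1 = (Fin.cons (t + s) y : Fin (n + 1) → ℝ) := by
  ext i
  refine Fin.cases ?_ (fun j => ?_) i <;> simp

theorem Fin.cons_add_smul_single_succ {n : ℕ} (t s : ℝ) (y : Fin n → ℝ) (j : Fin n) :
    (Fin.cons t y : Fin (n + 1) → ℝ) + s • Pi.single j.succ 1 =
      (Fin.cons t (y + s • Pi.single j 1 : Fin n → ℝ) : Fin (n + 1) → ℝ) := by
  ext i
  refine Fin.cases ?_ (fun k => ?_) i
  · simp
  · simp [Pi.single_apply]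

theorem contDiff_cons {n : ℕ} {E : Type*} [NormedAddCommGroup E] [NormedSpace ℝ E]
    {u : E → ℝ} {v : E → Fin n → ℝ} {m : WithTop ℕ∞} (hu : ContDiff ℝ m u) (hv : ContDiff ℝ m v) :
    ContDiff ℝ m fun z => (Fin.cons (u z) (v z) : Fin (n + 1) → ℝ) := by
  rw [contDiff_pi]
  intro i
  refine Fin.cases ?_ (fun j => ?_) i
  · simpa using hu
  · simpa using (contDiff_pi.1 hv j)

open ProbabilityTheory in
/-- The Gaussian logarithmic Sobolev inequality, by tensorization. -/
theorem entropy_pi_gaussianReal_le {n : ℕ} {f : (Fin n → ℝ) → ℝ} (hf : ContDiff ℝ 1 f)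
    {c C : ℝ} (hc : 0 < c) (hcf : ∀ x, c ≤ f x) (hfC : ∀ x, f x ≤ C) :
    ENNReal.ofReal (entropy (Measure.pi fun _ : Fin n => gaussianReal 0 1) f) ≤
      ∫⁻ x, ∑ i, ENNReal.ofReal (lineDeriv ℝ f x (Pi.single i 1) ^ 2 / (2 * f x))
        ∂Measure.pi fun _ : Fin n => gaussianReal 0 1 := by
  induction n with
  | zero =>
    have : entropy (Measure.pi fun _ : Fin 0 => gaussianReal 0 1) f = 0 := by
      have hf0 : f = fun _ => f 0 := funext fun x => congrArg f (Subsingleton.elim _ _)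
      rw [hf0]
      simp [entropy]
    simp [this]
  | succ n ih =>
    set γ := gaussianReal 0 1
    set e := (MeasurableEquiv.piFinSuccAbove (fun _ : Fin (n + 1) => ℝ) 0).symm with he
    have hep : MeasurePreserving e (γ.prod (Measure.pi fun _ : Fin n => γ))
        (Measure.pi fun _ : Fin (n + 1) => γ) :=
      (measurePreserving_piFinSuccAbove (fun _ : Fin (n + 1) => γ) 0).symm
    have hez : ∀ z, e z = Fin.cons z.1 z.2 := fun z => by
      simp [he, MeasurableEquiv.piFinSuccAbove_symm_apply, Fin.insertNthEquiv]
    set D : Fin (n + 1) → (Fin (n + 1) → ℝ) → ℝ≥0∞ := fun i x =>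
      ENNReal.ofReal (lineDeriv ℝ f x (Pi.single i 1) ^ 2 / (2 * f x)) with hD
    have hfm : Measurable f := hf.continuous.measurable
    have hDm : ∀ i, Measurable (D i) := fun i =>
      (((measurable_lineDeriv hf.continuous).pow_const 2).div
        (hfm.const_mul 2)).ennreal_ofReal
    have hem : Measurable fun z : ℝ × (Fin n → ℝ) => f (e z) := hfm.comp e.measurable
    have hent := entropy_map (μ := γ.prod (Measure.pi fun _ : Fin n => γ)) e.measurable hfm
    rw [hep.map_eq] at hent
    rw [hent, ← hep.lintegral_comp_emb e.measurableEmbedding]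
    have hsum : ∫⁻ z, ∑ i, D i (e z) ∂γ.prod (Measure.pi fun _ : Fin n => γ) =
        (∫⁻ t, ∫⁻ y, ∑ j : Fin n, D j.succ (e (t, y)) ∂(Measure.pi fun _ : Fin n => γ) ∂γ) +
          ∫⁻ y, ∫⁻ t, D 0 (e (t, y)) ∂γ ∂(Measure.pi fun _ : Fin n => γ) := by
      have m0 : Measurable fun z => D 0 (e z) := (hDm 0).comp e.measurable
      have m1 : Measurable fun z => ∑ j : Fin n, D j.succ (e z) :=
        Finset.measurable_sum _ fun j _ => (hDm j.succ).comp e.measurable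
      simp only [Fin.sum_univ_succ]
      rw [lintegral_add_left m0, add_comm, lintegral_prod _ m1.aemeasurable,
        lintegral_prod_symm _ m0.aemeasurable]
    rw [hsum]
    refine (ofReal_entropy_prod_le hem hc (fun z => hcf _) fun z => hfC _).trans
      (add_le_add (lintegral_mono fun t => ?_) (lintegral_mono fun y => ?_))
    · have h := ih (f := fun y => f (e (t, y))) (by
        simp only [hez]
        exact hf.comp (contDiff_cons contDiff_const contDiff_id)) (fun y => hcf _) fun y => hfC _
      refine h.trans_eq (lintegral_congr fun y => Finset.sum_congr rfl fun j _ => ?_)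
      simp only [hD, hez, lineDeriv, Fin.cons_add_smul_single_succ]
    · have hfd : Differentiable ℝ f := hf.differentiable one_ne_zero
      refine entropy_gaussianReal_le
        (f' := fun t => lineDeriv ℝ f (e (t, y)) (Pi.single 0 1)) (fun t => ?_) ?_ hc
        (fun t => hcf _) fun t => hfC _
      · have h := (hfd (e (t, y))).lineDifferentiableAt (v := Pi.single 0 1) |>.hasLineDerivAt
        unfold HasLineDerivAt at h
        simp only [hez, Fin.cons_add_smul_single_zero] at h ⊢
        have h2 : HasDerivAt (fun s : ℝ => s - t) 1 t := (hasDerivAt_id t).sub_const t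
        have h3 := h.comp_of_eq t h2 (sub_self t).symm
        simpa [Function.comp_def] using h3
      · simp only [(hfd _).lineDeriv_eq_fderiv, hez]
        exact ((hf.continuous_fderiv one_ne_zero).comp
          (contDiff_cons (m := 0) contDiff_id contDiff_const).continuous).clm_apply
          continuous_const

/-! ### The chi distribution -/

/-- The value of `∫ r ^ p * exp (-r² / 2)` over `(0, ∞)`, for `-1 < p`. -/
noncomputable def chiNorm (p : ℝ) : ℝ :=
  (1 / 2 : ℝ) ^ (-(p + 1) / 2) * (Real.Gamma ((p + 1) / 2) / 2)

theorem chiNorm_pos {p : ℝ} (hp : -1 < p) : 0 < chiNorm p := by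
  have := Real.Gamma_pos_of_pos (s := (p + 1) / 2) (by linarith)
  unfold chiNorm
  positivity

theorem chiNorm_add_two {p : ℝ} (hp : -1 < p) : chiNorm (p + 2) = (p + 1) * chiNorm p := by
  unfold chiNorm
  have e1 : (p + 2 + 1) / 2 = (p + 1) / 2 + 1 := by ring
  have e2 : -(p + 2 + 1) / 2 = -(p + 1) / 2 - 1 := by ring
  rw [e1, e2, Real.Gamma_add_one (by linarith), Real.rpow_sub_one (by norm_num)]
  ring

theorem integral_rpow_mul_exp_neg_half_mul_sq {p t : ℝ} (hp : -1 < p) (ht : 0 < t) :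
    ∫ r in Ioi (0 : ℝ), r ^ p * Real.exp (-(1 / 2 * t) * r ^ 2) =
      chiNorm p * t ^ (-((p + 1) / 2)) := by
  have h := integral_rpow_mul_exp_neg_mul_rpow (p := 2) (q := p) (b := 1 / 2 * t) two_pos hp
    (by positivity)
  simp only [Real.rpow_two] at h
  rw [h, Real.mul_rpow (by norm_num) ht.le, chiNorm, neg_div]
  ring

/-- The density on `(0, ∞)`, with respect to Lebesgue measure, of the chi distribution with
`a + 1` degrees of freedom; it is proportional to `r ^ a * exp (-r² / 2)`. -/
noncomputable def chiDensity (a r : ℝ) : ℝ :=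
  (chiNorm a)⁻¹ * (r ^ a * Real.exp (-(1 / 2) * r ^ 2))

/-- The chi distribution with `a + 1` degrees of freedom: the law of the norm of a standard
Gaussian vector of `ℝᵃ⁺¹` when `a` is an integer. -/
noncomputable def chiMeasure (a : ℝ) : Measure ℝ :=
  (volume.restrict (Ioi 0)).withDensity fun r => ENNReal.ofReal (chiDensity a r)

theorem measurable_chiDensity (a : ℝ) : Measurable (chiDensity a) := by
  unfold chiDensity
  fun_prop

theorem chiDensity_pos {a r : ℝ} (ha : -1 < a) (hr : 0 < r) : 0 < chiDensity a r := by
  unfold chiDensity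
  have := chiNorm_pos ha
  positivity

theorem integrableOn_chiDensity {a : ℝ} (ha : -1 < a) : IntegrableOn (chiDensity a) (Ioi 0) :=
  (integrableOn_rpow_mul_exp_neg_mul_sq one_half_pos ha).const_mul _

theorem integral_chiDensity {a : ℝ} (ha : -1 < a) : ∫ r in Ioi 0, chiDensity a r = 1 := by
  unfold chiDensity
  have h := integral_rpow_mul_exp_neg_half_mul_sq ha one_pos
  simp only [mul_one, Real.one_rpow] at h
  rw [integral_const_mul, h, inv_mul_cancel₀ (chiNorm_pos ha).ne']

theorem isProbabilityMeasure_chiMeasure {a : ℝ} (ha : -1 < a) :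
    IsProbabilityMeasure (chiMeasure a) := by
  constructor
  rw [chiMeasure, withDensity_apply _ MeasurableSet.univ, Measure.restrict_univ,
    ← ofReal_integral_eq_lintegral_ofReal (integrableOn_chiDensity ha)
      ((ae_restrict_iff' measurableSet_Ioi).2 (Eventually.of_forall fun r hr =>
        (chiDensity_pos ha hr).le)), integral_chiDensity ha, ENNReal.ofReal_one]

/-- The logarithmic Sobolev inequality for the chi distribution: `-log` of its density is
`r² / 2 - a log r` up to a constant, whose second derivative is at least `1` since `0 ≤ a`. -/
theorem entropy_chiMeasure_le {a : ℝ} (ha : 0 ≤ a) {f f' : ℝ → ℝ}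
    (hf : ∀ r, 0 < r → HasDerivAt f (f' r) r) (hf' : ContinuousOn f' (Ioi 0)) {c C : ℝ}
    (hc : 0 < c) (hcf : ∀ r, c ≤ f r) (hfC : ∀ r, f r ≤ C) :
    ENNReal.ofReal (entropy (chiMeasure a) f) ≤
      ∫⁻ r, ENNReal.ofReal (f' r ^ 2 / (2 * f r)) ∂chiMeasure a := by
  have ha' : -1 < a := by linarith
  set k := (chiNorm a)⁻¹ with hk
  have hk0 : 0 < k := inv_pos.2 (chiNorm_pos ha')
  have hlog : ∀ r, 0 < r → Real.log (chiDensity a r) =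
      Real.log k + (a * Real.log r + -(1 / 2) * r ^ 2) := fun r hr => by
    rw [chiDensity, Real.log_mul hk0.ne' (by positivity), Real.log_mul (by positivity)
      (Real.exp_pos _).ne', Real.log_exp, Real.log_rpow hr]
  have hnat : ∀ k : ℕ, (0 : ℝ) ≤ k := fun k => k.cast_nonneg
  refine entropy_le_lintegral_of_aecover measurableSet_Ioi
    (a := fun k : ℕ => 1 / ((k : ℝ) + 1)) (b := fun k : ℕ => (k : ℝ) + 2)
    (l := fun r => a / r - r) (fun k => ?_) (fun k x hx => ?_) ⟨?_, fun _ => measurableSet_Icc⟩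
    (fun r hr => ?_) (fun r hr => chiDensity_pos ha' hr) ?_ (fun r hr t ht => ?_)
    (integrableOn_chiDensity ha') (integral_chiDensity ha') hf hf' hc
    (fun r _ => hcf r) (fun r _ => hfC r)
  · have := hnat k
    rw [div_lt_iff₀ (by linarith)]
    nlinarith
  · have := hnat k
    exact lt_of_lt_of_le (by positivity) hx.1
  · refine (ae_restrict_iff' measurableSet_Ioi).2 (Eventually.of_forall fun r hr => ?_)
    have h1 : ∀ᶠ k : ℕ in atTop, 1 / ((k : ℝ) + 1) < r :=
      tendsto_one_div_add_atTop_nhds_zero_nat.eventually_lt_const hr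
    have h2 : ∀ᶠ k : ℕ in atTop, r < (k : ℝ) :=
      tendsto_natCast_atTop_atTop.eventually_gt_atTop r
    filter_upwards [h1, h2] with k hk1 hk2
    exact ⟨hk1.le, by linarith⟩
  · have hr0 : r ≠ 0 := (mem_Ioi.1 hr).ne'
    have h1 : HasDerivAt (fun r : ℝ => -(1 / 2) * r ^ 2) (-r) r :=
      ((hasDerivAt_pow 2 r).const_mul (-(1 / 2))).congr_deriv (by push_cast; ring)
    have h2 := (Real.hasDerivAt_rpow_const (p := a) (Or.inl hr0)).mul h1.exp
    refine (h2.const_mul k).congr_deriv ?_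
    rw [chiDensity, ← hk, Real.rpow_sub_one hr0]
    field_simp
    ring
  · exact (continuousOn_const.div continuousOn_id fun r hr => (mem_Ioi.1 hr).ne').sub
      continuousOn_id
  · rw [mem_Ioi] at hr ht
    rw [hlog r hr, hlog t ht]
    have h1 := Real.log_le_sub_one_of_pos (div_pos ht hr)
    rw [Real.log_div ht.ne' hr.ne'] at h1
    have h2 := mul_le_mul_of_nonneg_left h1 ha
    have h3 : (a / r - r) * (t - r) - (t - r) ^ 2 / 2 =
        a * (t / r - 1) + (r ^ 2 - t ^ 2) / 2 := by
      field_simp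
      ring
    rw [h3]
    linarith

/-! ### The Gaussian vector divided by an independent chi variable -/

open ProbabilityTheory in
theorem pi_gaussianReal_eq_withDensity (n : ℕ) :
    (Measure.pi fun _ : Fin n => gaussianReal 0 1) =
      volume.withDensity fun y => ENNReal.ofReal (∏ i, gaussianPDFReal 0 1 (y i)) := by
  refine Measure.pi_eq fun s hs => ?_
  rw [withDensity_apply _ (MeasurableSet.univ_pi hs), volume_pi, Measure.restrict_pi_pi,
    ← ofReal_integral_eq_lintegral_ofReal,
    integral_fintype_prod_eq_prod (μ := fun i => volume.restrict (s i))
      (f := fun _ => gaussianPDFReal 0 1), ENNReal.ofReal_prod_of_nonneg]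
  · refine Finset.prod_congr rfl fun i _ => ?_
    rw [gaussianReal_apply_eq_integral 0 one_ne_zero]
  · exact fun i _ => integral_nonneg fun x => gaussianPDFReal_nonneg 0 1 x
  · exact Integrable.fintype_prod fun i => (integrable_gaussianPDFReal 0 1).integrableOn
  · exact Eventually.of_forall fun y => Finset.prod_nonneg fun i _ =>
      gaussianPDFReal_nonneg 0 1 _

open ProbabilityTheory in
theorem prod_gaussianPDFReal (n : ℕ) (v : EuclideanSpace ℝ (Fin n)) :
    ∏ i, gaussianPDFReal 0 1 (v i) =
      (Real.sqrt (2 * Real.pi))⁻¹ ^ n * Real.exp (-(1 / 2) * ‖v‖ ^ 2) := by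
  simp only [gaussianPDFReal, NNReal.coe_one, mul_one, sub_zero]
  rw [Finset.prod_mul_distrib, ← Real.exp_sum, EuclideanSpace.real_norm_sq_eq, Finset.mul_sum]
  simp only [Finset.prod_const, Finset.card_univ, Fintype.card_fin]
  congr 2
  exact Finset.sum_congr rfl fun i _ => by ring

open ProbabilityTheory in
theorem lintegral_pi_gaussianReal {n : ℕ} {G : EuclideanSpace ℝ (Fin n) → ℝ≥0∞}
    (hG : Measurable G) :
    ∫⁻ y, G (WithLp.toLp 2 y) ∂(Measure.pi fun _ : Fin n => gaussianReal 0 1) =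
      ∫⁻ v, ENNReal.ofReal
        ((Real.sqrt (2 * Real.pi))⁻¹ ^ n * Real.exp (-(1 / 2) * ‖v‖ ^ 2)) * G v := by
  have hm : Measurable fun y : Fin n → ℝ =>
      ENNReal.ofReal (∏ i, gaussianPDFReal 0 1 (y i)) :=
    (Finset.measurable_prod _ fun i _ =>
      (measurable_gaussianPDFReal 0 1).comp (measurable_pi_apply i)).ennreal_ofReal
  have hL : Measurable fun y : Fin n → ℝ => G (WithLp.toLp 2 y) :=
    hG.comp (MeasurableEquiv.toLp 2 (Fin n → ℝ)).measurable
  rw [pi_gaussianReal_eq_withDensity, lintegral_withDensity_eq_lintegral_mul _ hm hL]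
  rw [← (EuclideanSpace.volume_preserving_symm_measurableEquiv_toLp (Fin n)).lintegral_comp_emb
    (MeasurableEquiv.measurableEmbedding _)]
  refine lintegral_congr fun v => ?_
  simp only [Pi.mul_apply]
  rw [← prod_gaussianPDFReal]
  rfl

theorem lintegral_comp_smul_eq {E : Type*} [NormedAddCommGroup E] [NormedSpace ℝ E]
    [MeasurableSpace E] [BorelSpace E] [FiniteDimensional ℝ E] (μ : Measure E)
    [μ.IsAddHaarMeasure] (G : E → ℝ≥0∞) {r : ℝ} (hr : 0 < r) :
    ∫⁻ v, G v ∂μ = ENNReal.ofReal (r ^ Module.finrank ℝ E) * ∫⁻ x, G (r • x) ∂μ := by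
  have h : ∫⁻ x, G (r • x) ∂μ = ∫⁻ v, G v ∂Measure.map (fun x => r • x) μ :=
    ((Homeomorph.smulOfNeZero r hr.ne').toMeasurableEquiv.measurableEmbedding.lintegral_map
      G).symm
  rw [h, Measure.map_addHaar_smul μ hr.ne', lintegral_smul_measure, smul_eq_mul, ← mul_assoc,
    ← ENNReal.ofReal_mul (by positivity), abs_of_pos (by positivity),
    mul_inv_cancel₀ (by positivity), ENNReal.ofReal_one, one_mul]

open ProbabilityTheory in
/-- If `R` has the chi distribution and `Y` is an independent standard Gaussian vector, this computes
the expectation of `R ^ s * H (Y / R)`: after the substitution `y = r x` the integral over `r` is a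
Gamma integral. -/
theorem lintegral_chiMeasure_prod_gaussian {n : ℕ} {a s : ℝ} (ha : -1 < a) (hs : -1 < a + s + n)
    {H : EuclideanSpace ℝ (Fin n) → ℝ≥0∞} (hH : Measurable H) :
    ∫⁻ z, ENNReal.ofReal (z.1 ^ s) * H (z.1⁻¹ • WithLp.toLp 2 z.2)
        ∂(chiMeasure a).prod (Measure.pi fun _ : Fin n => gaussianReal 0 1) =
      ENNReal.ofReal ((chiNorm a)⁻¹ * (Real.sqrt (2 * Real.pi))⁻¹ ^ n * chiNorm (a + s + n)) *
        ∫⁻ x, ENNReal.ofReal ((1 + ‖x‖ ^ 2) ^ (-((a + s + n + 1) / 2))) * H x := by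
  set κ := (Real.sqrt (2 * Real.pi))⁻¹ ^ n with hκ
  have hκ0 : 0 < κ := by positivity
  have hN := chiNorm_pos ha
  have hN' := chiNorm_pos hs
  set k := (chiNorm a)⁻¹ * κ with hk
  have hk0 : 0 < k := by positivity
  have hL : Measurable fun y : Fin n → ℝ => (WithLp.toLp 2 y : EuclideanSpace ℝ (Fin n)) :=
    (MeasurableEquiv.toLp 2 (Fin n → ℝ)).measurable
  have hm1 : Measurable fun z : ℝ × (Fin n → ℝ) =>
      ENNReal.ofReal (z.1 ^ s) * H (z.1⁻¹ • WithLp.toLp 2 z.2) :=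
    (measurable_fst.pow_const s).ennreal_ofReal.mul
      (hH.comp (measurable_fst.inv.smul (hL.comp measurable_snd)))
  rw [lintegral_prod _ hm1.aemeasurable, chiMeasure,
    lintegral_withDensity_eq_lintegral_mul _ (measurable_chiDensity a).ennreal_ofReal
      hm1.lintegral_prod_right']
  -- For fixed `r`, substitute `y = r x`.
  have hr : ∀ r ∈ Ioi (0 : ℝ),
      ENNReal.ofReal (chiDensity a r) *
        ∫⁻ y, ENNReal.ofReal (r ^ s) * H (r⁻¹ • WithLp.toLp 2 y)
          ∂(Measure.pi fun _ : Fin n => gaussianReal 0 1) =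
      ∫⁻ x, ENNReal.ofReal
        (k * (r ^ (a + s + n) * Real.exp (-(1 / 2 * (1 + ‖x‖ ^ 2)) * r ^ 2))) * H x := by
    intro r hr
    rw [mem_Ioi] at hr
    rw [lintegral_pi_gaussianReal (G := fun v => ENNReal.ofReal (r ^ s) * H (r⁻¹ • v))
      ((hH.comp (measurable_const_smul r⁻¹)).const_mul _), lintegral_comp_smul_eq _ _ hr,
      finrank_euclideanSpace_fin, ← lintegral_const_mul', ← lintegral_const_mul']
    · refine lintegral_congr fun x => ?_
      rw [inv_smul_smul₀ hr.ne', ← mul_assoc, ← mul_assoc, ← mul_assoc,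
        ← ENNReal.ofReal_mul (chiDensity_pos ha hr).le,
        ← ENNReal.ofReal_mul (mul_nonneg (chiDensity_pos ha hr).le (by positivity)),
        ← ENNReal.ofReal_mul (mul_nonneg (mul_nonneg (chiDensity_pos ha hr).le (by positivity))
          (by positivity))]
      congr 2
      have e1 : r ^ (a + s + n) = r ^ a * r ^ s * r ^ n := by
        rw [Real.rpow_add_natCast hr.ne', Real.rpow_add hr]
      have e2 : Real.exp (-(1 / 2 * (1 + ‖x‖ ^ 2)) * r ^ 2) =
          Real.exp (-(1 / 2) * r ^ 2) * Real.exp (-(1 / 2) * ‖r • x‖ ^ 2) := by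
        rw [← Real.exp_add, norm_smul, Real.norm_eq_abs, abs_of_pos hr]
        congr 1
        ring
      rw [e1, e2, chiDensity, hk]
      ring
    · exact ENNReal.ofReal_ne_top
    · exact ENNReal.ofReal_ne_top
  refine (setLIntegral_congr_fun measurableSet_Ioi hr).trans ?_
  have hm2 : Measurable fun z : ℝ × EuclideanSpace ℝ (Fin n) => ENNReal.ofReal
      (k * (z.1 ^ (a + s + n) * Real.exp (-(1 / 2 * (1 + ‖z.2‖ ^ 2)) * z.1 ^ 2))) * H z.2 := by
    refine Measurable.mul (Measurable.ennreal_ofReal ?_) (hH.comp measurable_snd)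
    fun_prop
  rw [lintegral_lintegral_swap hm2.aemeasurable, ← lintegral_const_mul' _ _ ENNReal.ofReal_ne_top]
  refine lintegral_congr fun x => ?_
  have hx : (0 : ℝ) < 1 + ‖x‖ ^ 2 := by positivity
  have hmx : Measurable fun r : ℝ => ENNReal.ofReal
      (k * (r ^ (a + s + n) * Real.exp (-(1 / 2 * (1 + ‖x‖ ^ 2)) * r ^ 2))) := by
    fun_prop
  rw [lintegral_mul_const _ hmx, ← mul_assoc, ← ENNReal.ofReal_mul (mul_pos hk0 hN').le,
    ← ofReal_integral_eq_lintegral_ofReal, integral_const_mul,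
    integral_rpow_mul_exp_neg_half_mul_sq hs hx, mul_assoc k]
  · exact (integrableOn_rpow_mul_exp_neg_mul_sq (by positivity) hs).const_mul _
  · refine (ae_restrict_iff' measurableSet_Ioi).2 (Eventually.of_forall fun r hr => ?_)
    have : (0 : ℝ) < r := hr
    simp only [Pi.zero_apply]
    positivity

theorem Real.rpow_neg_two_eq (r : ℝ) : r ^ (-2 : ℝ) = r⁻¹ ^ 2 := by
  have := Real.rpow_intCast r (-2)
  push_cast at this
  rw [this, zpow_neg, inv_pow]
  norm_cast

theorem lineDeriv_smul_toLp {n : ℕ} {f : EuclideanSpace ℝ (Fin n) → ℝ} (hf : Differentiable ℝ f)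
    (r : ℝ) (y : Fin n → ℝ) (i : Fin n) :
    lineDeriv ℝ (fun y => f (r • WithLp.toLp 2 y)) y (Pi.single i 1) =
      r * gradient f (r • WithLp.toLp 2 y) i := by
  have h1 : lineDeriv ℝ (fun y => f (r • WithLp.toLp 2 y)) y (Pi.single i 1) =
      lineDeriv ℝ f (r • WithLp.toLp 2 y) (r • WithLp.toLp 2 (Pi.single i 1)) := by
    unfold lineDeriv
    congr 1
    ext t
    beta_reduce
    rw [WithLp.toLp_add, WithLp.toLp_smul, smul_add, smul_comm r t]
  rw [h1, (hf _).lineDeriv_eq_fderiv, ← inner_gradient_left, inner_smul_right]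
  change r * inner ℝ _ (EuclideanSpace.single i (1 : ℝ)) = _
  rw [EuclideanSpace.inner_single_right]
  simp

theorem sum_lineDeriv_smul_toLp {n : ℕ} {f : EuclideanSpace ℝ (Fin n) → ℝ}
    (hf : Differentiable ℝ f) (hf0 : ∀ x, 0 < f x) (r : ℝ) (y : Fin n → ℝ) :
    ∑ i, ENNReal.ofReal (lineDeriv ℝ (fun y => f (r • WithLp.toLp 2 y)) y (Pi.single i 1) ^ 2 /
        (2 * f (r • WithLp.toLp 2 y))) =
      ENNReal.ofReal (r ^ 2 * (‖gradient f (r • WithLp.toLp 2 y)‖ ^ 2 /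
        (2 * f (r • WithLp.toLp 2 y)))) := by
  have h0 := hf0 (r • WithLp.toLp 2 y)
  rw [← ENNReal.ofReal_sum_of_nonneg fun i _ => by positivity, ← Finset.sum_div,
    EuclideanSpace.real_norm_sq_eq, ← mul_div_assoc, Finset.mul_sum]
  congr 2
  exact Finset.sum_congr rfl fun i _ => by rw [lineDeriv_smul_toLp hf, mul_pow]

theorem hasDerivAt_comp_inv_smul {E : Type*} [NormedAddCommGroup E] [NormedSpace ℝ E]
    {f : E → ℝ} (hf : Differentiable ℝ f) (v : E) {r : ℝ} (hr : r ≠ 0) :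
    HasDerivAt (fun r : ℝ => f (r⁻¹ • v)) (-(r⁻¹ * fderiv ℝ f (r⁻¹ • v) (r⁻¹ • v))) r := by
  have h1 : HasDerivAt (fun r : ℝ => r⁻¹ • v) (-(r ^ 2)⁻¹ • v) r :=
    (hasDerivAt_inv hr).smul_const v
  refine ((hf (r⁻¹ • v)).hasFDerivAt.comp_hasDerivAt r h1).congr_deriv ?_
  simp only [map_smul, smul_eq_mul]
  field_simp

open ProbabilityTheory in
/-- The logarithmic Sobolev inequality for `(R, Y)` applied to `f (Y / R)`. With `X = Y / R`, the
squared gradient of `f (Y / R)` is `(|∇f X|² + ⟨∇f X, X⟩²) / R²`, at most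
`|∇f X|² (1 + |X|²) / R²`. -/
theorem entropy_chiMeasure_prod_gaussian_le {n : ℕ} {a : ℝ} (ha : 0 ≤ a)
    {f : EuclideanSpace ℝ (Fin n) → ℝ} (hf : ContDiff ℝ 1 f) {c C : ℝ} (hc : 0 < c)
    (hcf : ∀ x, c ≤ f x) (hfC : ∀ x, f x ≤ C) :
    ENNReal.ofReal (entropy ((chiMeasure a).prod (Measure.pi fun _ : Fin n => gaussianReal 0 1))
        fun z => f (z.1⁻¹ • WithLp.toLp 2 z.2)) ≤
      ∫⁻ z, ENNReal.ofReal (z.1 ^ (-2 : ℝ)) *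
        (fun x => ENNReal.ofReal (‖gradient f x‖ ^ 2 * (1 + ‖x‖ ^ 2) / (2 * f x)))
          (z.1⁻¹ • WithLp.toLp 2 z.2)
        ∂(chiMeasure a).prod (Measure.pi fun _ : Fin n => gaussianReal 0 1) := by
  have := isProbabilityMeasure_chiMeasure (a := a) (by linarith)
  set γ := Measure.pi fun _ : Fin n => gaussianReal 0 1
  set X : ℝ × (Fin n → ℝ) → EuclideanSpace ℝ (Fin n) := fun z => z.1⁻¹ • WithLp.toLp 2 z.2 with hX
  have hLc : Continuous fun y : Fin n → ℝ => (WithLp.toLp 2 y : EuclideanSpace ℝ (Fin n)) :=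
    PiLp.continuous_toLp 2 _
  have hXm : Measurable X := measurable_fst.inv.smul (hLc.measurable.comp measurable_snd)
  have hfd : Differentiable ℝ f := hf.differentiable one_ne_zero
  have hf0 : ∀ x, 0 < f x := fun x => hc.trans_le (hcf x)
  have hgc : Continuous (gradient f) :=
    (InnerProductSpace.toDual ℝ (EuclideanSpace ℝ (Fin n))).symm.continuous.comp
      (hf.continuous_fderiv one_ne_zero)
  have hfm : Measurable f := hf.continuous.measurable
  set A : ℝ × (Fin n → ℝ) → ℝ≥0∞ := fun z =>
    ENNReal.ofReal (z.1⁻¹ ^ 2 * (‖gradient f (X z)‖ ^ 2 / (2 * f (X z)))) with hA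
  set B : ℝ × (Fin n → ℝ) → ℝ≥0∞ := fun z =>
    ENNReal.ofReal (z.1⁻¹ ^ 2 * (‖gradient f (X z)‖ ^ 2 * ‖X z‖ ^ 2 / (2 * f (X z)))) with hB
  have hAm : Measurable A :=
    ((measurable_fst.inv.pow_const 2).mul
      (((hgc.measurable.comp hXm).norm.pow_const 2).div
        ((hfm.comp hXm).const_mul 2))).ennreal_ofReal
  have hBm : Measurable B :=
    ((measurable_fst.inv.pow_const 2).mul
      ((((hgc.measurable.comp hXm).norm.pow_const 2).mul (hXm.norm.pow_const 2)).div
        ((hfm.comp hXm).const_mul 2))).ennreal_ofReal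
  have hAB : ∀ z : ℝ × (Fin n → ℝ), ENNReal.ofReal (z.1 ^ (-2 : ℝ)) *
      ENNReal.ofReal (‖gradient f (X z)‖ ^ 2 * (1 + ‖X z‖ ^ 2) / (2 * f (X z))) =
      A z + B z := by
    intro z
    -- `Real.rpow_neg_two_eq` holds for every real `r`, so no restriction to `0 < r` is needed here.
    have := hf0 (X z)
    rw [hA, hB, ← ENNReal.ofReal_add (by positivity) (by positivity), Real.rpow_neg_two_eq,
      ← ENNReal.ofReal_mul (by positivity)]
    congr 1
    ring
  rw [lintegral_congr hAB, lintegral_add_left hAm, lintegral_prod _ hAm.aemeasurable,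
    lintegral_prod_symm _ hBm.aemeasurable]
  refine (ofReal_entropy_prod_le (hfm.comp hXm) hc (fun z => hcf _) fun z => hfC _).trans
    (add_le_add (lintegral_mono fun r => ?_) (lintegral_mono fun y => ?_))
  · refine (entropy_pi_gaussianReal_le (f := fun y => f (r⁻¹ • WithLp.toLp 2 y)) ?_ hc
      (fun z => hcf _) fun z => hfC _).trans_eq
      (lintegral_congr fun y => sum_lineDeriv_smul_toLp hfd hf0 _ _)
    exact hf.comp ((PiLp.contDiff_toLp (p := 2)).const_smul r⁻¹)
  · refine (entropy_chiMeasure_le ha (f := fun r => f (r⁻¹ • WithLp.toLp 2 y))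
      (fun r hr => hasDerivAt_comp_inv_smul hfd (WithLp.toLp 2 y) hr.ne') ?_ hc (fun z => hcf _)
      fun z => hfC _).trans (lintegral_mono fun r => ENNReal.ofReal_le_ofReal ?_)
    · have h1 : ContinuousOn (fun r : ℝ => r⁻¹) (Ioi 0) :=
        continuousOn_inv₀.mono fun r hr => (mem_Ioi.1 hr).ne'
      have h2 : ContinuousOn (fun r : ℝ => r⁻¹ • (WithLp.toLp 2 y : EuclideanSpace ℝ (Fin n)))
        (Ioi 0) := h1.smul continuousOn_const
      exact (h1.mul (((hf.continuous_fderiv one_ne_zero).comp_continuousOn h2).clm_apply h2)).neg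
    · have h0 := hf0 (r⁻¹ • WithLp.toLp 2 y)
      have h1 := abs_real_inner_le_norm (gradient f (r⁻¹ • WithLp.toLp 2 y))
        (r⁻¹ • WithLp.toLp 2 y)
      rw [inner_gradient_left] at h1
      have h2 := pow_le_pow_left₀ (abs_nonneg _) h1 2
      rw [sq_abs, mul_pow] at h2
      rw [neg_sq, mul_pow, mul_div_assoc]
      simp only [hX]
      gcongr

/-! ### Generalized Cauchy distributions -/

theorem lintegral_cauchyMeasure {n : ℕ} {β : ℝ} (h : (n : ℝ) / 2 < β)
    {H : EuclideanSpace ℝ (Fin n) → ℝ≥0∞} (hH : Measurable H) :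
    ∫⁻ x, H x ∂cauchyMeasure n β =
      ENNReal.ofReal (cauchyZ n β)⁻¹ * ∫⁻ x, ENNReal.ofReal (cauchyDensity n β x) * H x := by
  have hd : Measurable (cauchyDensity n β) := by
    unfold cauchyDensity
    fun_prop
  rw [cauchyMeasure, lintegral_withDensity_eq_lintegral_mul _
    (hd.const_mul (cauchyZ n β)⁻¹).ennreal_ofReal hH,
    ← lintegral_const_mul' _ _ ENNReal.ofReal_ne_top]
  refine lintegral_congr fun x => ?_
  simp only [Pi.mul_apply]
  rw [ENNReal.ofReal_mul (inv_nonneg.2 (cauchyZ_pos h).le), mul_assoc]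

section
variable {n : ℕ} {β : ℝ}

open ProbabilityTheory in
/-- The constant in the law of `Y / R` is identified by comparing total masses. -/
theorem chiNorm_mul_eq_inv_cauchyZ (hβ : ((n : ℝ) + 1) / 2 ≤ β) :
    (chiNorm (2 * β - n - 1))⁻¹ * (Real.sqrt (2 * Real.pi))⁻¹ ^ n * chiNorm (2 * β - 1) =
      (cauchyZ n β)⁻¹ := by
  have hn : (0 : ℝ) ≤ n := n.cast_nonneg
  have hβ' : (n : ℝ) / 2 < β := by linarith
  have ha : -1 < 2 * β - n - 1 := by linarith
  have := isProbabilityMeasure_chiMeasure ha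
  have h := lintegral_chiMeasure_prod_gaussian (n := n) (s := 0) ha (by linarith)
    (H := fun _ => 1) measurable_const
  have e1 : 2 * β - n - 1 + 0 + n = 2 * β - 1 := by ring
  have e2 : (2 * β - 1 + 1) / 2 = β := by ring
  simp only [Real.rpow_zero, ENNReal.ofReal_one, mul_one, lintegral_const, measure_univ, e1,
    e2] at h
  change 1 = _ * ∫⁻ x, ENNReal.ofReal (cauchyDensity n β x) at h
  rw [← ofReal_integral_eq_lintegral_ofReal (integrable_cauchyDensity hβ')
    (Eventually.of_forall fun x => (cauchyDensity_pos n β x).le)] at h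
  have hp : 0 < chiNorm (2 * β - 1) := chiNorm_pos (by linarith)
  have hq := chiNorm_pos ha
  rw [← ENNReal.ofReal_mul (by positivity), eq_comm, ENNReal.ofReal_eq_one] at h
  exact eq_inv_of_mul_eq_one_left h

open ProbabilityTheory in
/-- The generalized Cauchy distribution is the law of `Y / R`, with `R` of chi distribution with
`2 β - n` degrees of freedom. -/
theorem map_chiMeasure_prod_gaussian (hβ : ((n : ℝ) + 1) / 2 ≤ β) :
    ((chiMeasure (2 * β - n - 1)).prod (Measure.pi fun _ : Fin n => gaussianReal 0 1)).map
        (fun z => (z.1⁻¹ • WithLp.toLp 2 z.2 : EuclideanSpace ℝ (Fin n))) =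
      cauchyMeasure n β := by
  have hn : (0 : ℝ) ≤ n := n.cast_nonneg
  have ha : -1 < 2 * β - n - 1 := by linarith
  have hX : Measurable fun z : ℝ × (Fin n → ℝ) =>
      (z.1⁻¹ • WithLp.toLp 2 z.2 : EuclideanSpace ℝ (Fin n)) :=
    measurable_fst.inv.smul ((PiLp.continuous_toLp 2 _).measurable.comp measurable_snd)
  refine Measure.ext_of_lintegral _ fun H hH => ?_
  have h := lintegral_chiMeasure_prod_gaussian (n := n) (s := 0) ha (by linarith) hH
  have e1 : 2 * β - n - 1 + 0 + n = 2 * β - 1 := by ring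
  have e2 : (2 * β - 1 + 1) / 2 = β := by ring
  simp only [Real.rpow_zero, ENNReal.ofReal_one, one_mul, e1, e2] at h
  rw [lintegral_map hH hX, h, lintegral_cauchyMeasure (by linarith) hH,
    chiNorm_mul_eq_inv_cauchyZ hβ]
  rfl

open ProbabilityTheory in
/-- The conditional expectation of `R⁻²` given `X = Y / R` is `(1 + |X|²) / (2 (β - 1))`. -/
theorem lintegral_rpow_neg_two_mul (hβ : ((n : ℝ) + 1) / 2 ≤ β) (hβ1 : 1 < β)
    {H : EuclideanSpace ℝ (Fin n) → ℝ≥0∞} (hH : Measurable H) :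
    ∫⁻ z, ENNReal.ofReal (z.1 ^ (-2 : ℝ)) * H (z.1⁻¹ • WithLp.toLp 2 z.2)
        ∂(chiMeasure (2 * β - n - 1)).prod (Measure.pi fun _ : Fin n => gaussianReal 0 1) =
      ENNReal.ofReal (1 / (2 * (β - 1))) *
        ∫⁻ x, ENNReal.ofReal (1 + ‖x‖ ^ 2) * H x ∂cauchyMeasure n β := by
  have hn : (0 : ℝ) ≤ n := n.cast_nonneg
  have ha : -1 < 2 * β - n - 1 := by linarith
  have hβ2 : 0 < β - 1 := by linarith
  have e1 : 2 * β - n - 1 + -2 + n = 2 * β - 3 := by ring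
  have e2 : (2 * β - 3 + 1) / 2 = β - 1 := by ring
  rw [lintegral_chiMeasure_prod_gaussian ha (by linarith) hH, e1, e2]
  have hm : Measurable fun x : EuclideanSpace ℝ (Fin n) => ENNReal.ofReal (1 + ‖x‖ ^ 2) * H x :=
    Measurable.mul (by fun_prop) hH
  rw [lintegral_cauchyMeasure (by linarith) hm, ← mul_assoc, ← ENNReal.ofReal_mul (by positivity),
    ← chiNorm_mul_eq_inv_cauchyZ hβ]
  have e3 : chiNorm (2 * β - 1) = (2 * (β - 1)) * chiNorm (2 * β - 3) := by
    have := chiNorm_add_two (p := 2 * β - 3) (by linarith)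
    rw [show 2 * β - 3 + 2 = 2 * β - 1 by ring] at this
    rw [this]
    ring
  congr 1
  · rw [e3]
    congr 1
    field_simp
  · refine lintegral_congr fun x => ?_
    have hx : (0 : ℝ) < 1 + ‖x‖ ^ 2 := by positivity
    rw [← mul_assoc, ← ENNReal.ofReal_mul (cauchyDensity_pos n β x).le, cauchyDensity]
    congr 2
    rw [neg_sub, sub_eq_neg_add, Real.rpow_add_one hx.ne']

open ProbabilityTheory in
/-- The weighted logarithmic Sobolev inequality for densities bounded away from `0` and `∞`. -/
theorem entropy_cauchyMeasure_le (hβ : ((n : ℝ) + 1) / 2 ≤ β) (hβ1 : 1 < β)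
    {f : EuclideanSpace ℝ (Fin n) → ℝ} (hf : ContDiff ℝ 1 f) {c C : ℝ} (hc : 0 < c)
    (hcf : ∀ x, c ≤ f x) (hfC : ∀ x, f x ≤ C) :
    ENNReal.ofReal (entropy (cauchyMeasure n β) f) ≤
      ENNReal.ofReal (1 / (2 * (β - 1))) * ∫⁻ x, ENNReal.ofReal (1 + ‖x‖ ^ 2) *
        ENNReal.ofReal (‖gradient f x‖ ^ 2 * (1 + ‖x‖ ^ 2) / (2 * f x))
          ∂cauchyMeasure n β := by
  have hX : Measurable fun z : ℝ × (Fin n → ℝ) =>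
      (z.1⁻¹ • WithLp.toLp 2 z.2 : EuclideanSpace ℝ (Fin n)) :=
    measurable_fst.inv.smul ((PiLp.continuous_toLp 2 _).measurable.comp measurable_snd)
  have hfm : Measurable f := hf.continuous.measurable
  have hgc : Continuous (gradient f) :=
    (InnerProductSpace.toDual ℝ (EuclideanSpace ℝ (Fin n))).symm.continuous.comp
      (hf.continuous_fderiv one_ne_zero)
  have hgm := hgc.measurable
  have hH : Measurable fun x : EuclideanSpace ℝ (Fin n) =>
      ENNReal.ofReal (‖gradient f x‖ ^ 2 * (1 + ‖x‖ ^ 2) / (2 * f x)) := by fun_prop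
  have hent : entropy (cauchyMeasure n β) f =
      entropy ((chiMeasure (2 * β - n - 1)).prod (Measure.pi fun _ : Fin n => gaussianReal 0 1))
        fun z => f (z.1⁻¹ • WithLp.toLp 2 z.2) := by
    rw [← map_chiMeasure_prod_gaussian hβ, entropy_map hX hfm]
  rw [hent, ← lintegral_rpow_neg_two_mul hβ hβ1 hH]
  exact entropy_chiMeasure_prod_gaussian_le (by linarith) hf hc hcf hfC

end

theorem norm_gradient_sq_add_const {E : Type*} [NormedAddCommGroup E] [InnerProductSpace ℝ E]
    [CompleteSpace E] {g : E → ℝ} {x : E} (hg : DifferentiableAt ℝ g x) (ε : ℝ) :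
    ‖gradient (fun y => g y ^ 2 + ε) x‖ ^ 2 = 4 * g x ^ 2 * ‖gradient g x‖ ^ 2 := by
  have h : HasFDerivAt (fun y => g y ^ 2 + ε) ((2 * g x) • fderiv ℝ g x) x := by
    have := (hg.hasFDerivAt.pow 2).add_const ε
    simpa using this
  rw [gradient, gradient, h.fderiv, LinearIsometryEquiv.norm_map, LinearIsometryEquiv.norm_map,
    norm_smul, mul_pow, Real.norm_eq_abs, sq_abs]
  ring

/-- Entropy is continuous under the regularization `f + 1 / (k + 1)`, which keeps `f` away from `0`. -/
theorem tendsto_entropy_add_const {α : Type*} [MeasurableSpace α] {μ : Measure α}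
    [IsProbabilityMeasure μ] {f : α → ℝ} (hf : Measurable f) (hf0 : ∀ x, 0 ≤ f x) {C : ℝ}
    (hfC : ∀ x, f x ≤ C) :
    Tendsto (fun k : ℕ => entropy μ fun x => f x + 1 / ((k : ℝ) + 1)) atTop
      (𝓝 (entropy μ f)) := by
  have he : Tendsto (fun k : ℕ => 1 / ((k : ℝ) + 1)) atTop (𝓝 0) :=
    tendsto_one_div_add_atTop_nhds_zero_nat
  have he0 : ∀ k : ℕ, 0 ≤ 1 / ((k : ℝ) + 1) := fun k => by positivity
  have he1 : ∀ k : ℕ, 1 / ((k : ℝ) + 1) ≤ 1 := fun k => by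
    have : (0 : ℝ) ≤ k := k.cast_nonneg
    rw [div_le_one (by linarith)]
    linarith
  have hadd : ∀ t : ℝ, Tendsto (fun k : ℕ => t + 1 / ((k : ℝ) + 1)) atTop (𝓝 t) := fun t => by
    simpa using he.const_add t
  obtain ⟨M, hM⟩ := (isCompact_Icc (a := (0 : ℝ)) (b := C + 1)).exists_bound_of_continuousOn
    Real.continuous_mul_log.continuousOn
  have hmean : Tendsto (fun k : ℕ => ∫ x, (f x + 1 / ((k : ℝ) + 1)) ∂μ) atTop
      (𝓝 (∫ x, f x ∂μ)) :=
    tendsto_integral_of_dominated_convergence (fun _ => C + 1)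
      (fun k => (hf.add_const _).aestronglyMeasurable) (integrable_const _)
      (fun k => Eventually.of_forall fun x => by
        rw [Real.norm_eq_abs, abs_of_nonneg (add_nonneg (hf0 x) (he0 k))]
        exact add_le_add (hfC x) (he1 k))
      (Eventually.of_forall fun x => hadd _)
  refine Tendsto.sub ?_ ((Real.continuous_mul_log.tendsto _).comp hmean)
  exact tendsto_integral_of_dominated_convergence (fun _ => M)
    (fun k => ((hf.add_const _).mul (hf.add_const _).log).aestronglyMeasurable)
    (integrable_const _)
    (fun k => Eventually.of_forall fun x =>
      hM _ ⟨add_nonneg (hf0 x) (he0 k), add_le_add (hfC x) (he1 k)⟩)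
    (Eventually.of_forall fun x => (Real.continuous_mul_log.tendsto _).comp (hadd _))

theorem theorem3p4 (n : ℕ) (β : ℝ) (hβn : ((n : ℝ) + 1) / 2 ≤ β) (hβ : 1 < β)
    (g : EuclideanSpace ℝ (Fin n) → ℝ) (hg : ContDiff ℝ ∞ g) (hb : ∃ C : ℝ, ∀ x, |g x| ≤ C) :
    ENNReal.ofReal (entropy (cauchyMeasure n β) (fun x => g x ^ 2)) ≤
      ENNReal.ofReal (1 / (β - 1)) *
        ∫⁻ x, ENNReal.ofReal (‖gradient g x‖ ^ 2 * (1 + ‖x‖ ^ 2) ^ 2) ∂(cauchyMeasure n β) := by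
  obtain ⟨C, hC⟩ := hb
  have hprob := isProbabilityMeasure_cauchyMeasure (n := n) (β := β) (by linarith)
  have hC2 : ∀ x, g x ^ 2 ≤ C ^ 2 := fun x => sq_le_sq' (abs_le.1 (hC x)).1 (abs_le.1 (hC x)).2
  have hβ0 : 0 < β - 1 := by linarith
  refine le_of_tendsto ((ENNReal.continuous_ofReal.tendsto _).comp
    (tendsto_entropy_add_const (hg.continuous.measurable.pow_const 2) (fun x => sq_nonneg _) hC2))
    (Eventually.of_forall fun k => ?_)
  have hε : 0 < 1 / ((k : ℝ) + 1) := by positivity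
  set ε := 1 / ((k : ℝ) + 1)
  refine (entropy_cauchyMeasure_le hβn hβ (f := fun x => g x ^ 2 + ε)
    (((hg.of_le (by simp)).pow 2).add contDiff_const) hε
    (fun x => by linarith [sq_nonneg (g x)]) (C := C ^ 2 + ε)
    (fun x => by linarith [hC2 x])).trans ?_
  -- `|∇(g² + ε)|² / (2 (g² + ε)) = 2 g² |∇g|² / (g² + ε) ≤ 2 |∇g|²`, uniformly in `ε`.
  have hpt : ∀ x : EuclideanSpace ℝ (Fin n), ENNReal.ofReal (1 + ‖x‖ ^ 2) *
      ENNReal.ofReal (‖gradient (fun y => g y ^ 2 + ε) x‖ ^ 2 * (1 + ‖x‖ ^ 2) /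
        (2 * (g x ^ 2 + ε))) ≤
      ENNReal.ofReal 2 * ENNReal.ofReal (‖gradient g x‖ ^ 2 * (1 + ‖x‖ ^ 2) ^ 2) := by
    intro x
    rw [norm_gradient_sq_add_const (hg.differentiable (by simp) x),
      ← ENNReal.ofReal_mul (by positivity), ← ENNReal.ofReal_mul (by positivity)]
    refine ENNReal.ofReal_le_ofReal ?_
    rw [← mul_div_assoc, div_le_iff₀ (by positivity)]
    have : 0 ≤ 4 * ε * (‖gradient g x‖ ^ 2 * (1 + ‖x‖ ^ 2) ^ 2) := by positivity
    linarith
  refine (mul_le_mul_right (lintegral_mono hpt) _).trans_eq ?_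
  rw [lintegral_const_mul' _ _ ENNReal.ofReal_ne_top, ← mul_assoc,
    ← ENNReal.ofReal_mul (by positivity)]
  congr 2
  field_simp
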